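/- A *directed monoidal category* (with strict unit) is a category $\mathcal C$ with a bifunctor $\Box:\mathcal C\times\mathcal C\to\mathcal C$, an object $0$ such that $0\,\Box\,-$ and $-\,\Box\,0$ are the identity functor, and a natural transformation $\eta_{A,B,C}:(A\Box B)\Box C\to A\Box(B\Box C)$, not necessarily invertible, which is the identity whenever one of $A,B,C$ is $0$, and which satisfies the pentagon identity $$\eta_{A,B,C\Box D}\circ\eta_{A\Box B,C,D}=(\mathrm{id}_A\Box\eta_{B,C,D})\circ\eta_{A,B\Box C,D}\circ(\eta_{A,B,C}\Box\mathrm{id}_D).$$ For $m\ge 0$ let $\mathcal L_m$ be the full subcategory of the free directed monoidal category on $m$ objects $x_1,\dots,x_m$ on those objects that become $x_1\Box x_2\Box\cdots\Box x_m$ after removing all parentheses (so $\mathcal L_0=\{0\}$). **Corollary (LaPlaza Coherence Theorem).** For every $m\ge 0$ the category $\mathcal L_m$ is a poset: any two parallel morphisms of $\mathcal L_m$ are equal, and if there are morphisms $S\to T$ and $T\to S$ then $S=T$. For $m\ge 3$ this poset is the Tamari lattice: sending a bracketed product to its underlying planar binary tree is a bijection from the objects of $\mathcal L_m$ onto the planar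 binary trees with $m$ leaves; there is a morphism $S\to T$ if and only if the tree of $T$ is obtained from that of $S$ by a finite sequence of rotations $(ab)c\to a(bc)$ of subtrees; and in this order any two trees have a least upper bound and a greatest lower bound. -/

import Mathlib

open CategoryTheory

universe v₁ v₂ u₁ u₂ u

/-- A directed monoidal category with a strict unit: a category with a bifunctor `box`, an object
`unit` such that `box unit -` and `box - unit` are the identity functor (on objects and on
morphisms), and a natural transformation `η : (A □ B) □ C ⟶ A □ (B □ C)`, not required to be
invertible, which is the identity as soon as one of `A`, `B`, `C` is the unit, and for which the
pentagon commutes. The morphisms `eqToHom _` are identities read along equalities of objects. -/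
class DirectedMonoidal (C : Type u₁) [Category.{v₁} C] where
  box : C → C → C
  unit : C
  boxHom : ∀ {A A' B B' : C}, (A ⟶ A') → (B ⟶ B') → (box A B ⟶ box A' B')
  boxHom_id : ∀ A B : C, boxHom (𝟙 A) (𝟙 B) = 𝟙 (box A B)
  boxHom_comp : ∀ {A A' A'' B B' B'' : C} (f : A ⟶ A') (f' : A' ⟶ A'') (g : B ⟶ B')
    (g' : B' ⟶ B''), boxHom (f ≫ f') (g ≫ g') = boxHom f g ≫ boxHom f' g'
  unit_box : ∀ A : C, box unit A = A
  box_unit : ∀ A : C, box A unit = A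
  unit_boxHom : ∀ {A A' : C} (f : A ⟶ A'),
    boxHom (𝟙 unit) f = eqToHom (unit_box A) ≫ f ≫ eqToHom (unit_box A').symm
  boxHom_unit : ∀ {A A' : C} (f : A ⟶ A'),
    boxHom f (𝟙 unit) = eqToHom (box_unit A) ≫ f ≫ eqToHom (box_unit A').symm
  η : ∀ A B D : C, box (box A B) D ⟶ box A (box B D)
  η_naturality : ∀ {A A' B B' D D' : C} (f : A ⟶ A') (g : B ⟶ B') (h : D ⟶ D'),
    boxHom (boxHom f g) h ≫ η A' B' D' = η A B D ≫ boxHom f (boxHom g h)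
  η_unit_left : ∀ B D : C, η unit B D = eqToHom (by rw [unit_box, unit_box])
  η_unit_mid : ∀ A D : C, η A unit D = eqToHom (by rw [box_unit, unit_box])
  η_unit_right : ∀ A B : C, η A B unit = eqToHom (by rw [box_unit, box_unit])
  pentagon : ∀ A B D E : C,
    η (box A B) D E ≫ η A B (box D E) =
      boxHom (η A B D) (𝟙 E) ≫ η A (box B D) E ≫ boxHom (𝟙 A) (η B D E)

/-! ### The free directed monoidal category on a set of objects -/

/-- The objects of the free directed monoidal category on `X`: the free unital magma on `X`. As the
unit is strict, an object is either the unit or a non-empty bracketed product of generators. -/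
inductive FreeObj (X : Type u) : Type u
  | unit : FreeObj X
  | tree : FreeMagma X → FreeObj X

namespace FreeObj

variable {X : Type u}

/-- The product of objects, with `unit` as a strict unit. -/
def box : FreeObj X → FreeObj X → FreeObj X
  | unit, B => B
  | tree s, unit => tree s
  | tree s, tree t => tree (s * t)

theorem unit_box (A : FreeObj X) : box unit A = A := rfl

theorem box_unit (A : FreeObj X) : box A unit = A := by cases A <;> rfl

end FreeObj

open FreeObj in
/-- Formal expressions for the morphisms of the free directed monoidal category on `X`. -/
inductive PreHom {X : Type u} : FreeObj X → FreeObj X → Type u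
  | id (A : FreeObj X) : PreHom A A
  | comp {A B D : FreeObj X} (f : PreHom A B) (g : PreHom B D) : PreHom A D
  | boxHom {A A' B B' : FreeObj X} (f : PreHom A A') (g : PreHom B B') :
      PreHom (box A B) (box A' B')
  | η (A B D : FreeObj X) : PreHom (box (box A B) D) (box A (box B D))

/-- Read a formal morphism along equalities of its source and of its target. -/
def PreHom.cast {X : Type u} {A A' B B' : FreeObj X} (hA : A = A') (hB : B = B')
    (f : PreHom A B) : PreHom A' B' := hA ▸ hB ▸ f

open FreeObj in
/-- The congruence on formal morphisms generated by the axioms of a directed monoidal category with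
a strict unit. -/
inductive PreHom.Rel {X : Type u} : ∀ {A B : FreeObj X}, PreHom A B → PreHom A B → Prop
  | refl {A B : FreeObj X} (f : PreHom A B) : Rel f f
  | symm {A B : FreeObj X} {f g : PreHom A B} : Rel f g → Rel g f
  | trans {A B : FreeObj X} {f g h : PreHom A B} : Rel f g → Rel g h → Rel f h
  | comp_congr {A B D : FreeObj X} {f f' : PreHom A B} {g g' : PreHom B D} :
      Rel f f' → Rel g g' → Rel (comp f g) (comp f' g')
  | boxHom_congr {A A' B B' : FreeObj X} {f f' : PreHom A A'} {g g' : PreHom B B'} :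
      Rel f f' → Rel g g' → Rel (boxHom f g) (boxHom f' g')
  | id_comp {A B : FreeObj X} (f : PreHom A B) : Rel (comp (id A) f) f
  | comp_id {A B : FreeObj X} (f : PreHom A B) : Rel (comp f (id B)) f
  | assoc {A B D E : FreeObj X} (f : PreHom A B) (g : PreHom B D) (h : PreHom D E) :
      Rel (comp (comp f g) h) (comp f (comp g h))
  | boxHom_id (A B : FreeObj X) : Rel (boxHom (id A) (id B)) (id (box A B))
  | boxHom_comp {A A' A'' B B' B'' : FreeObj X} (f : PreHom A A') (f' : PreHom A' A'')
      (g : PreHom B B') (g' : PreHom B' B'') :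
      Rel (boxHom (comp f f') (comp g g')) (comp (boxHom f g) (boxHom f' g'))
  | unit_boxHom {A A' : FreeObj X} (f : PreHom A A') :
      Rel (boxHom (id unit) f) (PreHom.cast (unit_box A).symm (unit_box A').symm f)
  | boxHom_unit {A A' : FreeObj X} (f : PreHom A A') :
      Rel (boxHom f (id unit)) (PreHom.cast (box_unit A).symm (box_unit A').symm f)
  | η_naturality {A A' B B' D D' : FreeObj X} (f : PreHom A A') (g : PreHom B B')
      (h : PreHom D D') :
      Rel (comp (boxHom (boxHom f g) h) (η A' B' D')) (comp (η A B D) (boxHom f (boxHom g h)))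
  | η_unit_left (B D : FreeObj X) :
      Rel (η unit B D) (PreHom.cast rfl (by rw [unit_box, unit_box]) (id (box (box unit B) D)))
  | η_unit_mid (A D : FreeObj X) :
      Rel (η A unit D) (PreHom.cast rfl (by rw [box_unit, unit_box]) (id (box (box A unit) D)))
  | η_unit_right (A B : FreeObj X) :
      Rel (η A B unit) (PreHom.cast rfl (by rw [box_unit, box_unit]) (id (box (box A B) unit)))
  | pentagon (A B D E : FreeObj X) :
      Rel (comp (η (box A B) D E) (η A B (box D E)))
        (comp (boxHom (η A B D) (id E)) (comp (η A (box B D) E) (boxHom (id A) (η B D E))))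

/-- Equality of morphisms in the free directed monoidal category. -/
def PreHom.setoid {X : Type u} (A B : FreeObj X) : Setoid (PreHom A B) where
  r := PreHom.Rel
  iseqv := ⟨PreHom.Rel.refl, PreHom.Rel.symm, PreHom.Rel.trans⟩

namespace FreeObj

variable {X : Type u}

instance category : Category.{u} (FreeObj X) where
  Hom A B := Quotient (PreHom.setoid A B)
  id A := Quotient.mk _ (PreHom.id A)
  comp f g := Quotient.map₂ PreHom.comp (fun _ _ h _ _ h' => PreHom.Rel.comp_congr h h') f g
  id_comp := by
    rintro A B ⟨f⟩
    exact Quotient.sound (PreHom.Rel.id_comp f)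
  comp_id := by
    rintro A B ⟨f⟩
    exact Quotient.sound (PreHom.Rel.comp_id f)
  assoc := by
    rintro A B D E ⟨f⟩ ⟨g⟩ ⟨h⟩
    exact Quotient.sound (PreHom.Rel.assoc f g h)

/-- The morphism represented by a formal expression. -/
def homMk {A B : FreeObj X} (f : PreHom A B) : A ⟶ B := Quotient.mk (PreHom.setoid A B) f

theorem homMk_cast {A A' B B' : FreeObj X} (hA : A = A') (hB : B = B') (f : PreHom A B) :
    homMk (PreHom.cast hA hB f) = eqToHom hA.symm ≫ homMk f ≫ eqToHom hB := by
  subst hA hB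
  simp [PreHom.cast]

instance directedMonoidal : DirectedMonoidal (FreeObj X) where
  box := box
  unit := unit
  boxHom f g := Quotient.map₂ PreHom.boxHom (fun _ _ h _ _ h' => PreHom.Rel.boxHom_congr h h') f g
  boxHom_id A B := Quotient.sound (PreHom.Rel.boxHom_id A B)
  boxHom_comp := by
    rintro A A' A'' B B' B'' ⟨f⟩ ⟨f'⟩ ⟨g⟩ ⟨g'⟩
    exact Quotient.sound (PreHom.Rel.boxHom_comp f f' g g')
  unit_box := unit_box
  box_unit := box_unit
  unit_boxHom := by
    rintro A A' ⟨f⟩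
    exact (Quotient.sound (PreHom.Rel.unit_boxHom f)).trans (homMk_cast _ _ f)
  boxHom_unit := by
    rintro A A' ⟨f⟩
    exact (Quotient.sound (PreHom.Rel.boxHom_unit f)).trans (homMk_cast _ _ f)
  η A B D := homMk (PreHom.η A B D)
  η_naturality := by
    rintro A A' B B' D D' ⟨f⟩ ⟨g⟩ ⟨h⟩
    exact Quotient.sound (PreHom.Rel.η_naturality f g h)
  η_unit_left B D := by
    refine (Quotient.sound (PreHom.Rel.η_unit_left B D)).trans ((homMk_cast _ _ _).trans ?_)
    exact (Category.id_comp _).trans (Category.id_comp _)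
  η_unit_mid A D := by
    refine (Quotient.sound (PreHom.Rel.η_unit_mid A D)).trans ((homMk_cast _ _ _).trans ?_)
    exact (Category.id_comp _).trans (Category.id_comp _)
  η_unit_right A B := by
    refine (Quotient.sound (PreHom.Rel.η_unit_right A B)).trans ((homMk_cast _ _ _).trans ?_)
    exact (Category.id_comp _).trans (Category.id_comp _)
  pentagon A B D E := Quotient.sound (PreHom.Rel.pentagon A B D E)

/-- The generating object attached to `x`. -/
def of (x : X) : FreeObj X := tree (FreeMagma.of x)

end FreeObj

/-! ### The universal property of the free directed monoidal category -/

/-- A functor that strictly preserves the product, the unit and the associativity morphisms. -/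
structure StrictFunctor (C : Type u₁) [Category.{v₁} C] [DirectedMonoidal C]
    (D : Type u₂) [Category.{v₂} D] [DirectedMonoidal D] extends C ⥤ D where
  obj_unit : obj DirectedMonoidal.unit = DirectedMonoidal.unit
  obj_box : ∀ A B : C,
    obj (DirectedMonoidal.box A B) = DirectedMonoidal.box (obj A) (obj B)
  map_boxHom : ∀ {A A' B B' : C} (f : A ⟶ A') (g : B ⟶ B'),
    map (DirectedMonoidal.boxHom f g) =
      eqToHom (obj_box A B) ≫ DirectedMonoidal.boxHom (map f) (map g) ≫
        eqToHom (obj_box A' B').symm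
  map_η : ∀ A B E : C,
    map (DirectedMonoidal.η A B E) =
      eqToHom (by rw [obj_box, obj_box]) ≫ DirectedMonoidal.η (obj A) (obj B) (obj E) ≫
        eqToHom (by rw [obj_box, obj_box])

namespace FreeObj

open DirectedMonoidal (boxHom_id boxHom_comp unit_boxHom boxHom_unit η_unit_left η_unit_mid
  η_unit_right)

variable {X : Type u} {D : Type u₂} [Category.{v₂} D] [DirectedMonoidal D]

theorem η_eqToHom {A A' B B' E E' : D} (p : A = A') (q : B = B') (r : E = E') :
    DirectedMonoidal.η A B E =
      eqToHom (by rw [p, q, r]) ≫ DirectedMonoidal.η A' B' E' ≫ eqToHom (by rw [p, q, r]) := by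
  subst p q r
  simp

theorem boxHom_conj_left {A₀ A A' A₁ B B' : D} (p : A₀ = A) (p' : A' = A₁) (f : A ⟶ A')
    (g : B ⟶ B') :
    DirectedMonoidal.boxHom (eqToHom p ≫ f ≫ eqToHom p') g =
      eqToHom (by rw [p]) ≫ DirectedMonoidal.boxHom f g ≫ eqToHom (by rw [p']) := by
  subst p p'
  simp

theorem boxHom_conj_right {A A' B₀ B B' B₁ : D} (q : B₀ = B) (q' : B' = B₁) (f : A ⟶ A')
    (g : B ⟶ B') :
    DirectedMonoidal.boxHom f (eqToHom q ≫ g ≫ eqToHom q') =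
      eqToHom (by rw [q]) ≫ DirectedMonoidal.boxHom f g ≫ eqToHom (by rw [q']) := by
  subst q q'
  simp

theorem boxHom_id_congr_left {A A' B B' : D} (p : A = A') (g : B ⟶ B') :
    DirectedMonoidal.boxHom (𝟙 A) g =
      eqToHom (by rw [p]) ≫ DirectedMonoidal.boxHom (𝟙 A') g ≫ eqToHom (by rw [p]) := by
  subst p
  simp

theorem boxHom_id_congr_right {A A' B B' : D} (p : B = B') (f : A ⟶ A') :
    DirectedMonoidal.boxHom f (𝟙 B) =
      eqToHom (by rw [p]) ≫ DirectedMonoidal.boxHom f (𝟙 B') ≫ eqToHom (by rw [p]) := by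
  subst p
  simp

/-- The extension of a function on generators to bracketed products. -/
def liftTree (φ : X → D) : FreeMagma X → D
  | FreeMagma.of x => φ x
  | FreeMagma.mul s t => DirectedMonoidal.box (liftTree φ s) (liftTree φ t)

/-- The extension of a function on generators to all objects. -/
def liftObj (φ : X → D) : FreeObj X → D
  | unit => DirectedMonoidal.unit
  | tree t => liftTree φ t

theorem liftObj_box (φ : X → D) (A B : FreeObj X) :
    liftObj φ (box A B) = DirectedMonoidal.box (liftObj φ A) (liftObj φ B) := by
  cases A with
  | unit => exact (DirectedMonoidal.unit_box _).symm
  | tree s =>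
    cases B with
    | unit => exact (DirectedMonoidal.box_unit _).symm
    | tree t => rfl

/-- The interpretation of formal morphisms in a directed monoidal category. -/
def liftHom (φ : X → D) : ∀ {A B : FreeObj X}, PreHom A B → (liftObj φ A ⟶ liftObj φ B)
  | _, _, PreHom.id A => 𝟙 (liftObj φ A)
  | _, _, PreHom.comp f g => liftHom φ f ≫ liftHom φ g
  | _, _, PreHom.boxHom (A := A) (A' := A') (B := B) (B' := B') f g =>
      eqToHom (liftObj_box φ A B) ≫ DirectedMonoidal.boxHom (liftHom φ f) (liftHom φ g) ≫
        eqToHom (liftObj_box φ A' B').symm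
  | _, _, PreHom.η A B E =>
      eqToHom (by rw [liftObj_box, liftObj_box]) ≫
        DirectedMonoidal.η (liftObj φ A) (liftObj φ B) (liftObj φ E) ≫
        eqToHom (by rw [liftObj_box, liftObj_box])

theorem liftHom_cast (φ : X → D) {A A' B B' : FreeObj X} (hA : A = A') (hB : B = B')
    (f : PreHom A B) :
    liftHom φ (PreHom.cast hA hB f) =
      eqToHom (by rw [hA]) ≫ liftHom φ f ≫ eqToHom (by rw [hB]) := by
  subst hA hB
  simp [PreHom.cast]

theorem liftHom_rel (φ : X → D) {A B : FreeObj X} {f g : PreHom A B} (h : PreHom.Rel f g) :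
    liftHom φ f = liftHom φ g := by
  have hu : liftObj φ unit = DirectedMonoidal.unit := rfl
  induction h with
  | refl f => rfl
  | symm _ ih => exact ih.symm
  | trans _ _ ih ih' => exact ih.trans ih'
  | comp_congr _ _ ih ih' => simp only [liftHom, ih, ih']
  | boxHom_congr _ _ ih ih' => simp only [liftHom, ih, ih']
  | id_comp f => simp [liftHom]
  | comp_id f => simp [liftHom]
  | assoc f g h => simp [liftHom]
  | boxHom_id A B => simp [liftHom, boxHom_id]
  | boxHom_comp f f' g g' => simp [liftHom, boxHom_comp]
  | unit_boxHom f =>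
    rw [liftHom_cast]
    simp [liftHom, boxHom_id_congr_left hu, unit_boxHom]
  | boxHom_unit f =>
    rw [liftHom_cast]
    simp [liftHom, boxHom_id_congr_right hu, boxHom_unit]
  | @η_naturality A A' B B' E E' f g h =>
    simp only [liftHom, boxHom_conj_left, boxHom_conj_right, Category.assoc, eqToHom_trans_assoc,
      eqToHom_refl, Category.id_comp]
    rw [← Category.assoc (DirectedMonoidal.boxHom _ _) (DirectedMonoidal.η _ _ _),
      DirectedMonoidal.η_naturality]
    simp
  | η_unit_left B E =>
    rw [liftHom_cast]
    simp [liftHom, η_eqToHom hu rfl rfl, η_unit_left]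
  | η_unit_mid A E =>
    rw [liftHom_cast]
    simp [liftHom, η_eqToHom rfl hu rfl, η_unit_mid]
  | η_unit_right A B =>
    rw [liftHom_cast]
    simp [liftHom, η_eqToHom rfl rfl hu, η_unit_right]
  | pentagon A B E F =>
    simp only [liftHom, boxHom_conj_left, boxHom_conj_right, η_eqToHom (liftObj_box φ A B) rfl rfl,
      η_eqToHom rfl (liftObj_box φ B E) rfl, η_eqToHom rfl rfl (liftObj_box φ E F),
      Category.assoc, eqToHom_trans_assoc, eqToHom_trans, eqToHom_refl, Category.id_comp]
    rw [← Category.assoc (DirectedMonoidal.η _ _ _) (DirectedMonoidal.η _ _ _),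
      DirectedMonoidal.pentagon]
    simp

/-- The strict functor that extends a function on generators. -/
def lift (φ : X → D) : StrictFunctor (FreeObj X) D where
  obj := liftObj φ
  map f := Quotient.lift (liftHom φ) (fun _ _ h => liftHom_rel φ h) f
  map_id _ := rfl
  map_comp := by
    rintro A B E ⟨f⟩ ⟨g⟩
    rfl
  obj_unit := rfl
  obj_box := liftObj_box φ
  map_boxHom := by
    rintro A A' B B' ⟨f⟩ ⟨g⟩
    rfl
  map_η _ _ _ := rfl

theorem strictFunctor_obj (φ : X → D) (F : StrictFunctor (FreeObj X) D)
    (h : ∀ x, F.obj (of x) = φ x) (A : FreeObj X) : F.obj A = liftObj φ A := by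
  cases A with
  | unit => exact F.obj_unit
  | tree t =>
    induction t with
    | ih1 x => exact h x
    | ih2 s t hs ht =>
      exact (F.obj_box (tree s) (tree t)).trans (congrArg₂ DirectedMonoidal.box hs ht)

theorem strictFunctor_map (φ : X → D) (F : StrictFunctor (FreeObj X) D)
    (h : ∀ x, F.obj (of x) = φ x) {A B : FreeObj X} (f : PreHom A B) :
    F.map (homMk f) = eqToHom (strictFunctor_obj φ F h A) ≫ liftHom φ f ≫
      eqToHom (strictFunctor_obj φ F h B).symm := by
  have hobj := strictFunctor_obj φ F h
  induction f with
  | id A =>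
    change F.map (𝟙 A) = _
    simp [liftHom]
  | comp f g hf hg =>
    change F.map (homMk f ≫ homMk g) = _
    simp [liftHom, hf, hg]
  | @boxHom A A' B B' f g hf hg =>
    change F.map (DirectedMonoidal.boxHom (homMk f) (homMk g)) = _
    rw [F.map_boxHom, hf, hg]
    simp only [liftHom, boxHom_conj_left, boxHom_conj_right, Category.assoc, eqToHom_trans,
      eqToHom_trans_assoc]
  | η A B E =>
    change F.map (DirectedMonoidal.η A B E) = _
    rw [F.map_η, η_eqToHom (hobj A) (hobj B) (hobj E)]
    simp only [liftHom, Category.assoc, eqToHom_trans, eqToHom_trans_assoc]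

/-- `FreeObj X` is the free directed monoidal category (with strict unit) on `X`. -/
theorem existsUnique_strictFunctor (φ : X → D) :
    ∃! F : StrictFunctor (FreeObj X) D, ∀ x, F.obj (of x) = φ x := by
  refine ⟨lift φ, fun _ => rfl, fun F hF => ?_⟩
  have key : F.toFunctor = (lift φ).toFunctor := by
    refine CategoryTheory.Functor.ext (strictFunctor_obj φ F hF) ?_
    rintro A B ⟨f⟩
    exact strictFunctor_map φ F hF f
  cases F
  cases key
  rfl

end FreeObj

/-! ### The categories `𝓛_m` and the Tamari lattice -/

/-- The word obtained from a bracketed product by removing all parentheses. -/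
def FreeMagma.leaves {X : Type u} : FreeMagma X → List X
  | FreeMagma.of x => [x]
  | FreeMagma.mul s t => leaves s ++ leaves t

/-- The word obtained from an object by removing all parentheses; it is empty for the unit. -/
def FreeObj.word {X : Type u} : FreeObj X → List X
  | FreeObj.unit => []
  | FreeObj.tree t => t.leaves

/-- The category `𝓛_m`: the full subcategory of the free directed monoidal category on `m`
generators on the objects that become `x_1 x_2 ⋯ x_m` after removing all parentheses. -/
abbrev LaPlaza (m : ℕ) : Type :=
  ObjectProperty.FullSubcategory (fun A : FreeObj (Fin m) => A.word = List.finRange m)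

/-- The planar binary tree underlying a bracketed product. -/
def FreeMagma.shape {X : Type u} : FreeMagma X → BinaryTree Unit
  | FreeMagma.of _ => BinaryTree.nil
  | FreeMagma.mul s t => BinaryTree.node () (shape s) (shape t)

/-- A single rotation `(ab)c ⟶ a(bc)`, performed at some node of a planar binary tree. -/
inductive Rotation : BinaryTree Unit → BinaryTree Unit → Prop
  | root (a b c : BinaryTree Unit) :
      Rotation (.node () (.node () a b) c) (.node () a (.node () b c))
  | left {a a' : BinaryTree Unit} (b : BinaryTree Unit) :
      Rotation a a' → Rotation (.node () a b) (.node () a' b)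
  | right (a : BinaryTree Unit) {b b' : BinaryTree Unit} :
      Rotation b b' → Rotation (.node () a b) (.node () a b')

/-- The planar binary trees with `m` leaves, that is, the complete bracketings of a product of `m`
factors. -/
def Tamari (m : ℕ) : Type := {t : BinaryTree Unit // t.numLeaves = m}

/-- The Tamari order: `s ≤ t` if `t` is obtained from `s` by a finite sequence of rotations. -/
instance Tamari.preorder (m : ℕ) : Preorder (Tamari m) where
  le s t := Relation.ReflTransGen Rotation s.1 t.1
  le_refl _ := Relation.ReflTransGen.refl
  le_trans _ _ _ h h' := h.trans h'

/-! ### Morphisms between bracketed products -/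

/-! Coherence rests on a normal form for morphisms into a product. A cut of `s` is a canonical
composite of associators from `s` to some `p □ q`. There is one for each node on the left spine of
`s`, and the length of `p` tells them apart. Every morphism into `t₁ □ t₂` is a cut of its source
followed by a product `a □ b`: the property `FactorsCuts` holds for the generating morphisms and is
stable under composition and products, the pentagon being what is needed for the associator. Since
morphisms preserve words, the source of `a` has the length of `t₁`, so parallel morphisms use the
same cut, and induction on the target makes them equal (`tree_hom_eq`).

On underlying trees a morphism is a sequence of rotations, and rotations lift back to morphisms;
tree and word together determine a bracketed product. Antisymmetry follows from a weight that every
rotation increases.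

For the lattice property, the Tamari order is the componentwise order of bracket vectors
(`Tamari.le_iff_bracket`). These vectors are closed under componentwise infima, which gives meets;
joins are meets of sets of upper bounds, nonempty because there is a greatest tree. -/

namespace FreeObj

variable {X : Type u}

/-- The product of two morphisms between bracketed products. -/
def treeBox {s s' t t' : FreeMagma X} (f : tree s ⟶ tree s') (g : tree t ⟶ tree t') :
    tree (.mul s t) ⟶ tree (.mul s' t') :=
  DirectedMonoidal.boxHom f g

/-- The associativity morphism for bracketed products. -/
def treeη (a b c : FreeMagma X) : tree (.mul (.mul a b) c) ⟶ tree (.mul a (.mul b c)) :=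
  DirectedMonoidal.η (tree a) (tree b) (tree c)

theorem treeBox_id (s t : FreeMagma X) : treeBox (𝟙 (tree s)) (𝟙 (tree t)) = 𝟙 _ :=
  DirectedMonoidal.boxHom_id (tree s) (tree t)

theorem treeBox_comp {s s' s'' t t' t'' : FreeMagma X} (f : tree s ⟶ tree s')
    (f' : tree s' ⟶ tree s'') (g : tree t ⟶ tree t') (g' : tree t' ⟶ tree t'') :
    treeBox (f ≫ f') (g ≫ g') = treeBox f g ≫ treeBox f' g' :=
  DirectedMonoidal.boxHom_comp f f' g g'

theorem treeη_naturality {a a' b b' c c' : FreeMagma X} (f : tree a ⟶ tree a')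
    (g : tree b ⟶ tree b') (h : tree c ⟶ tree c') :
    treeBox (treeBox f g) h ≫ treeη a' b' c' = treeη a b c ≫ treeBox f (treeBox g h) :=
  DirectedMonoidal.η_naturality f g h

theorem treeη_pentagon (a b c d : FreeMagma X) :
    treeη (.mul a b) c d ≫ treeη a b (.mul c d) =
      treeBox (treeη a b c) (𝟙 _) ≫ treeη a (.mul b c) d ≫ treeBox (𝟙 _) (treeη b c d) :=
  DirectedMonoidal.pentagon (tree a) (tree b) (tree c) (tree d)

/-- The canonical morphisms `(⋯((P □ Q₁) □ Q₂)⋯) □ Qₙ ⟶ P □ ((⋯(Q₁ □ Q₂)⋯) □ Qₙ)`, one for each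
node on the left spine of the source. -/
inductive IsCut : ∀ {s p q : FreeMagma X}, (tree s ⟶ tree (.mul p q)) → Prop
  | root (p q : FreeMagma X) : IsCut (𝟙 (tree (.mul p q)))
  | step {s p q : FreeMagma X} {c : tree s ⟶ tree (.mul p q)} (r : FreeMagma X) :
      IsCut c → IsCut (treeBox c (𝟙 (tree r)) ≫ treeη p q r)

/-- This separates the two constructors: a cut of `s □ r` built by `step` has a left factor strictly
shorter than `s`, which is the left factor of the root cut. -/
theorem IsCut.length_lt {s p q : FreeMagma X} {c : tree s ⟶ tree (.mul p q)} (h : IsCut c) :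
    p.length < s.length := by
  induction h with
  | root p q => simpa [FreeMagma.length] using q.length_pos
  | step r _ ih => simp only [FreeMagma.length]; omega

/-- A cut is determined by its source and the length of its left factor. -/
theorem IsCut.eq_of_length_eq {s p q p' q' : FreeMagma X} {c : tree s ⟶ tree (.mul p q)}
    {c' : tree s ⟶ tree (.mul p' q')} (h : IsCut c) (h' : IsCut c')
    (hl : p.length = p'.length) :
    (⟨p, q, c⟩ : Σ p q : FreeMagma X, tree s ⟶ tree (.mul p q)) = ⟨p', q', c'⟩ := by
  induction h generalizing p' q' with
  | root p q =>
    cases h' with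
    | root => rfl
    | step r h₀ => exact absurd hl h₀.length_lt.ne'
  | step r h₀ ih =>
    cases h' with
    | root => exact absurd hl h₀.length_lt.ne
    | step r' h₁ =>
      cases ih h₁ hl
      rfl

/-- A morphism factors through cuts if every cut of its target can be pulled back along it to a
cut of its source, and if it is an identity as soon as its target is a generator. -/
structure FactorsCuts {s t : FreeMagma X} (f : tree s ⟶ tree t) : Prop where
  exists_cut : ∀ {p q : FreeMagma X} {c : tree t ⟶ tree (.mul p q)}, IsCut c →
    ∃ (p' q' : FreeMagma X) (c' : tree s ⟶ tree (.mul p' q')) (a : tree p' ⟶ tree p)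
      (b : tree q' ⟶ tree q), IsCut c' ∧ f ≫ c = c' ≫ treeBox a b
  eq_of : ∀ x : X, t = FreeMagma.of x → ∃ h : tree s = tree t, f = eqToHom h

theorem FactorsCuts.id (t : FreeMagma X) : FactorsCuts (𝟙 (tree t)) where
  exists_cut {p q c} h := ⟨p, q, c, 𝟙 _, 𝟙 _, h, by simp [treeBox_id]⟩
  eq_of _ _ := ⟨rfl, rfl⟩

theorem FactorsCuts.comp {s t r : FreeMagma X} {f : tree s ⟶ tree t} {g : tree t ⟶ tree r}
    (hf : FactorsCuts f) (hg : FactorsCuts g) : FactorsCuts (f ≫ g) where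
  exists_cut h := by
    obtain ⟨p₁, q₁, c₁, a₁, b₁, h₁, e₁⟩ := hg.exists_cut h
    obtain ⟨p₂, q₂, c₂, a₂, b₂, h₂, e₂⟩ := hf.exists_cut h₁
    refine ⟨p₂, q₂, c₂, a₂ ≫ a₁, b₂ ≫ b₁, h₂, ?_⟩
    rw [Category.assoc, e₁, reassoc_of% e₂, treeBox_comp]
  eq_of x hx := by
    obtain ⟨h, rfl⟩ := hg.eq_of x hx
    obtain rfl : t = r := FreeObj.tree.inj h
    simpa using hf.eq_of x hx

/-- The root cut pulls back to the root cut. Any deeper cut lives on the left spine, hence in the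
left factor, where `f` pulls it back; naturality of the associator then moves the remaining factor
across. Nothing is needed of `g`. -/
theorem FactorsCuts.treeBox {s s' t t' : FreeMagma X} {f : tree s ⟶ tree s'}
    (hf : FactorsCuts f) (g : tree t ⟶ tree t') : FactorsCuts (treeBox f g) where
  exists_cut h := by
    cases h with
    | root => exact ⟨s, t, 𝟙 _, f, g, .root _ _, by simp⟩
    | step r h₀ =>
      obtain ⟨p, q, c, a, b, hc, e⟩ := hf.exists_cut h₀
      refine ⟨p, _, _, a, FreeObj.treeBox b g, .step t hc, ?_⟩
      rw [← Category.assoc, ← treeBox_comp, e, Category.comp_id, Category.assoc,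
        ← treeη_naturality, ← Category.assoc, ← treeBox_comp, Category.id_comp]
  eq_of x hx := nomatch hx

/-- The root cut of `a(bd)` pulls back to the cut of `(ab)d` given by the associator itself. A cut
coming from one of `a` pulls back to the same cut two levels deeper, and the square commutes by the
pentagon. -/
theorem FactorsCuts.treeη (a b d : FreeMagma X) : FactorsCuts (treeη a b d) where
  exists_cut h := by
    cases h with
    | root =>
      refine ⟨a, _, _, 𝟙 _, 𝟙 _, .step d (.root a b), ?_⟩
      simp [treeBox_id]
    | step r h₀ =>
      refine ⟨_, _, _, 𝟙 _, FreeObj.treeη _ b d, .step d (.step b h₀), ?_⟩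
      rename_i p q c
      have key := treeη_naturality c (𝟙 (tree b)) (𝟙 (tree d))
      rw [treeBox_id] at key
      have e := treeBox_comp (FreeObj.treeBox c (𝟙 (tree b))) (FreeObj.treeη p q b)
        (𝟙 (tree d)) (𝟙 (tree d))
      rw [Category.comp_id] at e
      rw [← reassoc_of% key, treeη_pentagon, e]
      simp only [Category.assoc]
  eq_of x hx := nomatch hx

/-- The motive for the induction on formal morphisms: the unit is isolated, with only the identity,
and between bracketed products the morphism factors through cuts. -/
def Normal : ∀ {A B : FreeObj X}, (A ⟶ B) → Prop
  | unit, unit, f => f = 𝟙 unit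
  | tree _, tree _, f => FactorsCuts f
  | unit, tree _, _ => False
  | tree _, unit, _ => False

theorem Normal.id (A : FreeObj X) : Normal (𝟙 A) := by
  cases A with
  | unit => rfl
  | tree t => exact FactorsCuts.id t

theorem Normal.eqToHom {A B : FreeObj X} (h : A = B) : Normal (eqToHom h) := by
  subst h
  exact Normal.id A

theorem Normal.conj {A A' B B' : FreeObj X} (h : A' = A) (h' : B = B') {f : A ⟶ B}
    (hf : Normal f) : Normal (CategoryTheory.eqToHom h ≫ f ≫ CategoryTheory.eqToHom h') := by
  subst h h'
  simpa using hf

/-- `Normal` is a property of the represented morphism, so only the generators need checking and the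
relations of `PreHom.Rel` play no role in the induction. The unit axioms reduce the cases involving
the unit to conjugation by `eqToHom`. -/
theorem normal_homMk {A B : FreeObj X} (f : PreHom A B) : Normal (homMk f) := by
  induction f with
  | id A => exact Normal.id A
  | @comp A B D f g hf hg =>
    change Normal (homMk f ≫ homMk g)
    -- The mixed cases vanish because `Normal` is `False` there.
    match A, B, D, f, g, hf, hg with
    | unit, unit, unit, f, g, hf, hg =>
      have hf : homMk f = 𝟙 unit := hf
      have hg : homMk g = 𝟙 unit := hg
      rw [hf, hg, Category.comp_id]
      rfl
    | tree _, tree _, tree _, f, g, hf, hg => exact FactorsCuts.comp hf hg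
  | @boxHom A A' B B' f g hf hg =>
    change Normal (DirectedMonoidal.boxHom (homMk f) (homMk g))
    match A, A', f, hf with
    | unit, unit, f, hf =>
      have hf : homMk f = 𝟙 unit := hf
      rw [hf]
      have e := DirectedMonoidal.unit_boxHom (homMk g)
      exact e ▸ hg.conj _ _
    | tree _, tree _, f, hf =>
      match B, B', g, hg with
      | unit, unit, g, hg =>
        have hg : homMk g = 𝟙 unit := hg
        rw [hg]
        have e := DirectedMonoidal.boxHom_unit (homMk f)
        exact e ▸ Normal.conj (A := tree _) (B := tree _) _ _ hf
      | tree _, tree _, g, hg => exact FactorsCuts.treeBox hf (homMk g)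
  | η A B D =>
    change Normal (DirectedMonoidal.η A B D)
    match A, B, D with
    | unit, B, D =>
      have e := DirectedMonoidal.η_unit_left B D
      exact e ▸ Normal.eqToHom _
    | A, unit, D =>
      have e := DirectedMonoidal.η_unit_mid A D
      exact e ▸ Normal.eqToHom _
    | A, B, unit =>
      have e := DirectedMonoidal.η_unit_right A B
      exact e ▸ Normal.eqToHom _
    | tree a, tree b, tree d => exact FactorsCuts.treeη a b d

theorem normal {A B : FreeObj X} (f : A ⟶ B) : Normal f := by
  obtain ⟨f⟩ := f
  exact normal_homMk f

/-! ### Invariance of words and coherence -/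

theorem word_box (A B : FreeObj X) : (box A B).word = A.word ++ B.word := by
  match A, B with
  | unit, _ => rfl
  | tree _, unit => simp [box, word]
  | tree _, tree _ => rfl

theorem word_eq_of_hom {A B : FreeObj X} (f : A ⟶ B) : A.word = B.word := by
  obtain ⟨f'⟩ := f
  clear f
  induction f' with
  | id A => rfl
  | comp f g hf hg => exact hf.trans hg
  | boxHom f g hf hg => rw [word_box, word_box, hf, hg]
  | η A B D => simp only [word_box, List.append_assoc]

theorem _root_.FreeMagma.length_leaves (t : FreeMagma X) : t.leaves.length = t.length := by
  induction t with
  | ih1 x => rfl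
  | ih2 s t hs ht => exact List.length_append.trans (congrArg₂ _ hs ht)

theorem length_eq_of_hom {s t : FreeMagma X} (f : tree s ⟶ tree t) : s.length = t.length := by
  rw [← s.length_leaves, ← t.length_leaves]
  exact congrArg List.length (word_eq_of_hom f)

/-- Coherence for bracketed products: parallel morphisms are equal. -/
theorem tree_hom_eq {s t : FreeMagma X} (f g : tree s ⟶ tree t) : f = g := by
  induction t generalizing s with
  | ih1 x =>
    obtain ⟨_, rfl⟩ := (show FactorsCuts f from normal f).eq_of x rfl
    obtain ⟨_, rfl⟩ := (show FactorsCuts g from normal g).eq_of x rfl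
    rfl
  | ih2 t₁ t₂ ih₁ ih₂ =>
    -- The root cut of the target is an identity, so pulling it back factors `f` itself.
    obtain ⟨p, q, c, a, b, hc, e⟩ :=
      (show FactorsCuts f from normal f).exists_cut (.root t₁ t₂)
    obtain ⟨p', q', c', a', b', hc', e'⟩ :=
      (show FactorsCuts g from normal g).exists_cut (.root t₁ t₂)
    -- Both left factors have the length of `t₁`, so the two cuts coincide.
    cases hc.eq_of_length_eq hc' ((length_eq_of_hom a).trans (length_eq_of_hom a').symm)
    rw [ih₁ a a', ih₂ b b', ← e'] at e
    exact (Category.comp_id f).symm.trans (Eq.trans e (Category.comp_id g))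

/-- Coherence: parallel morphisms of the free directed monoidal category are equal. -/
theorem hom_eq {A B : FreeObj X} (f g : A ⟶ B) : f = g := by
  match A, B, f, g, normal f, normal g with
  | unit, unit, f, g, hf, hg => exact Eq.trans hf (Eq.symm hg)
  | tree s, tree t, f, g, _, _ => exact tree_hom_eq f g

end FreeObj

/-! ### Morphisms and rotations -/

namespace BinaryTree

/-- The sum over all nodes of the sizes of their right subtrees. -/
def weight : BinaryTree Unit → ℕ
  | nil => 0
  | node _ a b => a.weight + b.weight + b.numNodes

end BinaryTree

namespace Rotation

open BinaryTree Relation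

theorem numNodes_eq {s t : BinaryTree Unit} (h : Rotation s t) : s.numNodes = t.numNodes := by
  induction h with
  | root a b c => simp only [numNodes]; omega
  | left b _ ih => simp only [numNodes, ih]
  | right a _ ih => simp only [numNodes, ih]

/-- Under `(ab)c → a(bc)` the node with right subtree `b` acquires `c` and one further node, while
the other right subtrees keep their sizes: the weight grows by the number of nodes of `c` plus one.
-/
theorem weight_lt {s t : BinaryTree Unit} (h : Rotation s t) : s.weight < t.weight := by
  induction h with
  | root a b c => simp only [weight, numNodes]; omega
  | left b _ ih => simp only [weight]; omega
  | right a h ih =>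
    have := h.numNodes_eq
    simp only [weight]; omega

theorem reflTransGen_numNodes_eq {s t : BinaryTree Unit} (h : ReflTransGen Rotation s t) :
    s.numNodes = t.numNodes := by
  induction h with
  | refl => rfl
  | tail _ h ih => exact ih.trans h.numNodes_eq

theorem eq_or_weight_lt {s t : BinaryTree Unit} (h : ReflTransGen Rotation s t) :
    s = t ∨ s.weight < t.weight := by
  induction h with
  | refl => exact .inl rfl
  | tail _ h ih =>
    right
    rcases ih with rfl | ih
    · exact h.weight_lt
    · exact ih.trans h.weight_lt

theorem reflTransGen_antisymm {s t : BinaryTree Unit} (h : ReflTransGen Rotation s t)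
    (h' : ReflTransGen Rotation t s) : s = t := by
  rcases eq_or_weight_lt h with rfl | h
  · rfl
  · rcases eq_or_weight_lt h' with rfl | h'
    · rfl
    · omega

theorem reflTransGen_node {a a' b b' : BinaryTree Unit} (ha : ReflTransGen Rotation a a')
    (hb : ReflTransGen Rotation b b') :
    ReflTransGen Rotation (.node () a b) (.node () a' b') :=
  (ha.lift (fun x => BinaryTree.node () x b) fun _ _ h => .left b h).trans
    (hb.lift (fun x => BinaryTree.node () a' x) fun _ _ h => .right a' h)

end Rotation

/-! ### Bracketed products as trees with labelled leaves -/

namespace FreeMagma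

variable {X : Type u}

theorem numLeaves_shape (t : FreeMagma X) : t.shape.numLeaves = t.leaves.length := by
  induction t with
  | ih1 x => rfl
  | ih2 s t hs ht => exact (congrArg₂ _ hs ht).trans List.length_append.symm

theorem exists_shape_leaves (s : BinaryTree Unit) (l : List X) (h : s.numLeaves = l.length) :
    ∃ t : FreeMagma X, t.shape = s ∧ t.leaves = l := by
  induction s generalizing l with
  | nil =>
    obtain ⟨x, rfl⟩ := List.length_eq_one_iff.mp h.symm
    exact ⟨of x, rfl, rfl⟩
  | node _ a b iha ihb =>
    rw [BinaryTree.numLeaves] at h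
    obtain ⟨ta, ha, hla⟩ := iha (l.take a.numLeaves) (by rw [List.length_take]; omega)
    obtain ⟨tb, hb, hlb⟩ := ihb (l.drop a.numLeaves) (by rw [List.length_drop]; omega)
    refine ⟨mul ta tb, by rw [shape, ha, hb], ?_⟩
    rw [leaves, hla, hlb, List.take_append_drop]

/-- The shape fixes the number of leaves on the left, hence the place where the word splits. -/
theorem eq_of_shape_of_leaves {s t : FreeMagma X} (h : s.shape = t.shape)
    (hl : s.leaves = t.leaves) : s = t := by
  induction s generalizing t with
  | ih1 x =>
    match t with
    | of y => rw [List.singleton_inj.mp hl]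
    | mul _ _ => cases h
  | ih2 s₁ s₂ ih₁ ih₂ =>
    match t with
    | of _ => cases h
    | mul t₁ t₂ =>
      obtain ⟨-, h₁, h₂⟩ := BinaryTree.node.inj h
      have hlen : s₁.leaves.length = t₁.leaves.length := by
        rw [← numLeaves_shape, ← numLeaves_shape, h₁]
      obtain ⟨hl₁, hl₂⟩ := List.append_inj hl hlen
      rw [ih₁ h₁ hl₁, ih₂ h₂ hl₂]
      rfl

end FreeMagma

/-! ### Morphisms as sequences of rotations -/

namespace FreeObj

variable {X : Type u}

open Relation

/-- The relation "reachable by rotations" between the underlying trees of two objects, with the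
unit in a component of its own. -/
def ShapeLE : FreeObj X → FreeObj X → Prop
  | unit, unit => True
  | tree s, tree t => ReflTransGen Rotation s.shape t.shape
  | unit, tree _ => False
  | tree _, unit => False

theorem ShapeLE.refl (A : FreeObj X) : ShapeLE A A := by
  cases A with
  | unit => trivial
  | tree t => exact ReflTransGen.refl

theorem shapeLE_of_hom {A B : FreeObj X} (f : A ⟶ B) : ShapeLE A B := by
  obtain ⟨f'⟩ := f
  clear f
  induction f' with
  | id A => exact .refl A
  | @comp A B D _ _ hf hg =>
    match A, B, D, hf, hg with
    | unit, unit, unit, _, _ => trivial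
    | tree _, tree _, tree _, hf, hg => exact ReflTransGen.trans hf hg
  | @boxHom A A' B B' _ _ hf hg =>
    match A, A', hf with
    | unit, unit, _ => exact hg
    | tree s, tree s', hf =>
      match B, B', hg with
      | unit, unit, _ => exact hf
      | tree t, tree t', hg => exact Rotation.reflTransGen_node hf hg
  | η A B D =>
    -- With a unit argument both bracketings compute to the same object.
    match A, B, D with
    | unit, B, D => exact .refl _
    | tree a, unit, D => exact .refl _
    | tree a, tree b, unit => exact .refl _
    | tree a, tree b, tree d => exact ReflTransGen.single (.root _ _ _)

/-- The labels of the target are left unspecified; `nonempty_hom_iff` recovers them afterwards from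
the invariance of words. -/
theorem exists_hom_of_rotation {s : FreeMagma X} {t' : BinaryTree Unit}
    (h : Rotation s.shape t') :
    ∃ t : FreeMagma X, t.shape = t' ∧ Nonempty (tree s ⟶ tree t) := by
  induction s generalizing t' with
  | ih1 x => cases h
  | ih2 s₁ s₂ ih₁ ih₂ =>
    change Rotation (.node () s₁.shape s₂.shape) t' at h
    generalize hs : s₁.shape = a at h
    cases h with
    | root a b c =>
      match s₁, hs with
      | .mul p q, hs =>
        obtain ⟨-, rfl, rfl⟩ := BinaryTree.node.inj hs
        exact ⟨.mul p (.mul q s₂), rfl, ⟨treeη p q s₂⟩⟩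
    | left _ h =>
      subst hs
      obtain ⟨t, rfl, ⟨f⟩⟩ := ih₁ h
      exact ⟨.mul t s₂, rfl, ⟨treeBox f (𝟙 _)⟩⟩
    | right _ h =>
      subst hs
      obtain ⟨t, rfl, ⟨f⟩⟩ := ih₂ h
      exact ⟨.mul s₁ t, rfl, ⟨treeBox (𝟙 _) f⟩⟩

theorem exists_hom_of_reflTransGen {s : FreeMagma X} {t' : BinaryTree Unit}
    (h : ReflTransGen Rotation s.shape t') :
    ∃ t : FreeMagma X, t.shape = t' ∧ Nonempty (tree s ⟶ tree t) := by
  induction h with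
  | refl => exact ⟨s, rfl, ⟨𝟙 _⟩⟩
  | tail _ h ih =>
    obtain ⟨t, rfl, ⟨f⟩⟩ := ih
    obtain ⟨r, hr, ⟨g⟩⟩ := exists_hom_of_rotation h
    exact ⟨r, hr, ⟨f ≫ g⟩⟩

/-- For bracketed products of the same word, morphisms correspond to sequences of rotations. -/
theorem nonempty_hom_iff {s t : FreeMagma X} (hl : s.leaves = t.leaves) :
    Nonempty (tree s ⟶ tree t) ↔ ReflTransGen Rotation s.shape t.shape := by
  refine ⟨fun ⟨f⟩ => shapeLE_of_hom f, fun h => ?_⟩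
  obtain ⟨r, hr, ⟨f⟩⟩ := exists_hom_of_reflTransGen h
  have hw : s.leaves = r.leaves := word_eq_of_hom f
  obtain rfl := FreeMagma.eq_of_shape_of_leaves hr (hw.symm.trans hl)
  exact ⟨f⟩

theorem hom_antisymm {A B : FreeObj X} (f : A ⟶ B) (g : B ⟶ A) : A = B := by
  match A, B, f, g, shapeLE_of_hom f, shapeLE_of_hom g with
  | unit, unit, _, _, _, _ => rfl
  | tree s, tree t, f, _, h, h' =>
    exact congrArg tree
      (FreeMagma.eq_of_shape_of_leaves (Rotation.reflTransGen_antisymm h h') (word_eq_of_hom f))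

end FreeObj

/-! ### Objects of `𝓛_m` as trees with `m` leaves -/

namespace LaPlaza

open FreeObj

theorem exists_tree {m : ℕ} (hm : 0 < m) (S : LaPlaza m) :
    ∃ t : FreeMagma (Fin m), S.obj = tree t := by
  obtain ⟨_ | t, hS⟩ := S
  · have := congrArg List.length hS
    simp [word] at this
    omega
  · exact ⟨t, rfl⟩

/-- Forgetting the labels identifies the objects of `𝓛_m` with the trees with `m` leaves, and
morphisms with sequences of rotations. -/
theorem exists_equiv_tamari {m : ℕ} (hm : 0 < m) :
    ∃ e : LaPlaza m ≃ Tamari m,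
      (∀ (S : LaPlaza m) (t : FreeMagma (Fin m)), S.obj = tree t → (e S).1 = t.shape) ∧
      (∀ S T : LaPlaza m, Nonempty (S ⟶ T) ↔ e S ≤ e T) := by
  choose τ hτ using exists_tree hm
  have hleaves (S : LaPlaza m) : (τ S).leaves = List.finRange m := by
    have := S.property
    rwa [hτ S] at this
  let e : LaPlaza m → Tamari m := fun S =>
    ⟨(τ S).shape, by rw [FreeMagma.numLeaves_shape, hleaves, List.length_finRange]⟩
  have he : Function.Bijective e := by
    constructor
    · intro S T h
      have h := FreeMagma.eq_of_shape_of_leaves (congrArg Subtype.val h)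
        ((hleaves S).trans (hleaves T).symm)
      exact ObjectProperty.FullSubcategory.ext ((hτ S).trans ((congrArg tree h).trans (hτ T).symm))
    · rintro ⟨s, hs⟩
      obtain ⟨t, rfl, ht⟩ := FreeMagma.exists_shape_leaves s (List.finRange m) (by simpa using hs)
      refine ⟨⟨tree t, ht⟩, Subtype.ext ?_⟩
      exact congrArg FreeMagma.shape (tree.inj (hτ ⟨tree t, ht⟩)).symm
  refine ⟨Equiv.ofBijective e he, fun S t h => ?_, fun S T => ?_⟩
  · exact congrArg FreeMagma.shape (tree.inj ((hτ S).symm.trans h))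
  · have key := nonempty_hom_iff ((hleaves S).trans (hleaves T).symm)
    rw [← hτ S, ← hτ T] at key
    exact Iff.trans ⟨fun ⟨f⟩ => ⟨f.hom⟩, fun ⟨f⟩ => ⟨ObjectProperty.homMk f⟩⟩ key

end LaPlaza

/-! ### Bracket vectors and the lattice property -/

namespace BinaryTree

open Relation

/-- The bracket vector of a tree: its `i`-th entry is the size of the right subtree of the `i`-th
node in the inorder traversal (and `0` if there is no such node). -/
def bracket : BinaryTree Unit → ℕ → ℕ
  | nil, _ => 0
  | node _ a b, i =>
    if i < a.numNodes then a.bracket i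
    else if i = a.numNodes then b.numNodes
    else b.bracket (i - a.numNodes - 1)

theorem bracket_node_of_lt {a b : BinaryTree Unit} {i : ℕ} (h : i < a.numNodes) :
    (node () a b).bracket i = a.bracket i := by
  rw [bracket, if_pos h]

theorem bracket_node_numNodes (a b : BinaryTree Unit) :
    (node () a b).bracket a.numNodes = b.numNodes := by
  rw [bracket, if_neg (lt_irrefl _), if_pos rfl]

theorem bracket_node_add (a b : BinaryTree Unit) (i : ℕ) :
    (node () a b).bracket (a.numNodes + 1 + i) = b.bracket i := by
  rw [bracket, if_neg (by omega), if_neg (by omega)]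
  congr 1
  omega

/-- The conditions that characterise bracket vectors of trees with `n` nodes. -/
structure IsBracket (n : ℕ) (v : ℕ → ℕ) : Prop where
  lt : ∀ i < n, i + v i < n
  -- For a tree, the interval from `i` to `i + v i` is node `i` with its right subtree; such
  -- intervals are nested or disjoint.
  nested : ∀ i j, i < n → i < j → j ≤ i + v i → j + v j ≤ i + v i

theorem isBracket_bracket (t : BinaryTree Unit) : IsBracket t.numNodes t.bracket := by
  induction t with
  | nil =>
    exact ⟨fun i h => absurd h (Nat.not_lt_zero i), fun i _ h => absurd h (Nat.not_lt_zero i)⟩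
  | node _ a b iha ihb =>
    constructor
    · intro i hi
      rw [numNodes] at hi ⊢
      rcases lt_trichotomy i a.numNodes with h | rfl | h
      · rw [bracket_node_of_lt h]
        have := iha.lt i h
        omega
      · rw [bracket_node_numNodes]
        omega
      · obtain ⟨k, rfl⟩ := Nat.exists_eq_add_of_le (Nat.succ_le_of_lt h)
        have := ihb.lt k (by omega)
        rw [bracket_node_add]
        omega
    · intro i j hi hij hj
      rw [numNodes] at hi
      rcases lt_trichotomy i a.numNodes with h | rfl | h
      · rw [bracket_node_of_lt h] at hj ⊢
        have := iha.lt i h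
        rw [bracket_node_of_lt (by omega)]
        exact iha.nested i j h hij hj
      · rw [bracket_node_numNodes] at hj ⊢
        obtain ⟨k, rfl⟩ := Nat.exists_eq_add_of_le (Nat.succ_le_of_lt hij)
        have := ihb.lt k (by omega)
        rw [bracket_node_add]
        omega
      · obtain ⟨k, rfl⟩ := Nat.exists_eq_add_of_le (Nat.succ_le_of_lt h)
        obtain ⟨l, rfl⟩ := Nat.exists_eq_add_of_le (Nat.succ_le_of_lt (h.trans hij))
        rw [bracket_node_add] at hj ⊢
        rw [bracket_node_add]
        have := ihb.nested k l (by omega) (by omega) (by omega)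
        omega

/-- The root must be the first position `k` whose interval reaches the last position `n - 1`. The
entries before and after `k` are again bracket vectors, which give the two subtrees. -/
theorem exists_bracket_eq {n : ℕ} {v : ℕ → ℕ} (h : IsBracket n v) :
    ∃ t : BinaryTree Unit, t.numNodes = n ∧ ∀ i < n, t.bracket i = v i := by
  induction n using Nat.strong_induction_on generalizing v with
  | _ n ih =>
    rcases Nat.eq_zero_or_pos n with rfl | hn
    · exact ⟨nil, rfl, fun i hi => absurd hi (Nat.not_lt_zero i)⟩
    -- The last entry is `0`, so the last position qualifies.
    have hex : ∃ k, k + v k + 1 = n := ⟨n - 1, by have := h.lt (n - 1) (by omega); omega⟩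
    classical
    have hk := Nat.find_spec hex
    have hmin := fun i => Nat.find_min hex (m := i)
    generalize Nat.find hex = k at hk hmin
    obtain ⟨a, ha, hav⟩ := ih k (by omega) (v := v)
      { lt := fun i hi => by
          -- An interval starting before `k` and reaching `k` would contain that of `k`, hence reach
          -- `n - 1`, against minimality.
          by_contra hc
          have h₁ := h.nested i k (by omega) hi (by omega)
          have h₂ := h.lt i (by omega)
          exact hmin i hi (by omega)
        nested := fun i j hi => h.nested i j (by omega) }
    obtain ⟨b, hb, hbv⟩ := ih (v k) (by omega) (v := fun i => v (k + 1 + i))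
      { lt := fun i hi => by have := h.lt (k + 1 + i) (by omega); omega
        nested := fun i j hi hij hj => by
          have := h.nested (k + 1 + i) (k + 1 + j) (by omega) (by omega) (by omega)
          omega }
    subst ha
    refine ⟨node () a b, by rw [numNodes]; omega, fun i hi => ?_⟩
    rcases lt_trichotomy i a.numNodes with h | rfl | h
    · rw [bracket_node_of_lt h, hav i h]
    · rw [bracket_node_numNodes, hb]
    · obtain ⟨l, rfl⟩ := Nat.exists_eq_add_of_le (Nat.succ_le_of_lt h)
      rw [bracket_node_add, hbv l (by omega)]

/-- A rotation keeps the inorder numbering of the nodes and enlarges a single right subtree, that of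
the node between `a` and `b`. -/
theorem bracket_le_of_rotation {s t : BinaryTree Unit} (h : Rotation s t) (i : ℕ) :
    s.bracket i ≤ t.bracket i := by
  induction h generalizing i with
  | root a b c =>
    have hab : (node () a b).numNodes = a.numNodes + b.numNodes + 1 := rfl
    rcases lt_trichotomy i a.numNodes with h | rfl | h
    · rw [bracket_node_of_lt h, bracket_node_of_lt (by omega), bracket_node_of_lt h]
    · rw [bracket_node_numNodes, bracket_node_of_lt (by omega), bracket_node_numNodes, numNodes]
      omega
    · obtain ⟨k, rfl⟩ := Nat.exists_eq_add_of_le (Nat.succ_le_of_lt h)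
      rw [bracket_node_add]
      rcases lt_trichotomy k b.numNodes with hk | rfl | hk
      · rw [bracket_node_of_lt (by omega), bracket_node_add, bracket_node_of_lt hk]
      · rw [bracket_node_numNodes,
          show a.numNodes.succ + b.numNodes = (node () a b).numNodes by omega,
          bracket_node_numNodes]
      · obtain ⟨l, rfl⟩ := Nat.exists_eq_add_of_le (Nat.succ_le_of_lt hk)
        rw [bracket_node_add,
          show a.numNodes.succ + (b.numNodes.succ + l) = (node () a b).numNodes + 1 + l by omega,
          bracket_node_add]
  | left b h ih =>
    simp only [bracket, h.numNodes_eq]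
    split_ifs <;> first | exact ih _ | exact le_rfl
  | right a h ih =>
    simp only [bracket, h.numNodes_eq]
    split_ifs <;> first | exact ih _ | exact le_rfl

theorem bracket_le_of_reflTransGen {s t : BinaryTree Unit} (h : ReflTransGen Rotation s t)
    (i : ℕ) : s.bracket i ≤ t.bracket i := by
  induction h with
  | refl => exact le_rfl
  | tail _ h ih => exact ih.trans (bracket_le_of_rotation h i)

/-- If no bracket opened before the `k`-th node extends beyond it, then the `k`-th node can be
rotated to the root, without changing any other entry of the bracket vector. -/
theorem exists_rotations_to_root {s : BinaryTree Unit} {k : ℕ} (hk : k < s.numNodes)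
    (h : ∀ i < k, i + s.bracket i < k) :
    ∃ p q : BinaryTree Unit, ReflTransGen Rotation s (node () p q) ∧ p.numNodes = k ∧
      (∀ i < k, p.bracket i = s.bracket i) ∧ ∀ i, q.bracket i = s.bracket (k + 1 + i) := by
  induction s with
  | nil => exact absurd hk (Nat.not_lt_zero k)
  | node _ a b iha _ =>
    rw [numNodes] at hk
    rcases lt_trichotomy k a.numNodes with hlt | rfl | hlt
    -- The node lies in the left subtree: bring it to the root there, then rotate `(pq)b` to
    -- `p(qb)`.
    · obtain ⟨p, q, hr, hp, hpv, hqv⟩ := iha hlt fun i hi => by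
        have := h i hi
        rwa [bracket_node_of_lt (hi.trans hlt)] at this
      have hn := Rotation.reflTransGen_numNodes_eq hr
      rw [numNodes] at hn
      refine ⟨p, node () q b, (Rotation.reflTransGen_node hr .refl).tail (.root p q b), hp,
        fun i hi => by rw [hpv i hi, bracket_node_of_lt (hi.trans hlt)], fun i => ?_⟩
      rcases lt_trichotomy i q.numNodes with hi | rfl | hi
      · rw [bracket_node_of_lt hi, bracket_node_of_lt (by omega), hqv]
      · rw [bracket_node_numNodes, show k + 1 + q.numNodes = a.numNodes by omega,
          bracket_node_numNodes]
      · obtain ⟨l, rfl⟩ := Nat.exists_eq_add_of_le (Nat.succ_le_of_lt hi)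
        rw [bracket_node_add, show k + 1 + (q.numNodes.succ + l) = a.numNodes + 1 + l by omega,
          bracket_node_add]
    · exact ⟨a, b, .refl, rfl, fun i hi => (bracket_node_of_lt hi).symm,
        fun i => (bracket_node_add a b i).symm⟩
    -- The interval of the root reaches the last position, so no later node satisfies the
    -- hypothesis.
    · have := h _ hlt
      rw [bracket_node_numNodes] at this
      omega

/-- Let `k` be the position of the root of `t`. The earlier entries of `s` are bounded by those of
`t`, so no earlier interval reaches `k` and this node can be rotated to the root of `s`. The two
pairs of subtrees are then compared by induction. -/
theorem reflTransGen_of_bracket_le {s t : BinaryTree Unit} (hn : s.numNodes = t.numNodes)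
    (h : ∀ i < t.numNodes, s.bracket i ≤ t.bracket i) : ReflTransGen Rotation s t := by
  induction t generalizing s with
  | nil =>
    match s, hn with
    | nil, _ => exact .refl
  | node _ a b iha ihb =>
    rw [numNodes] at hn h
    have ha : ∀ i < a.numNodes, s.bracket i ≤ a.bracket i := fun i hi => by
      rw [← bracket_node_of_lt (b := b) hi]
      exact h i (by omega)
    obtain ⟨p, q, hr, hp, hpv, hqv⟩ := exists_rotations_to_root (s := s) (k := a.numNodes)
      (by omega) fun i hi => by
        have h₁ := ha i hi
        have h₂ := (isBracket_bracket a).lt i hi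
        omega
    have hn' := Rotation.reflTransGen_numNodes_eq hr
    rw [numNodes] at hn'
    refine hr.trans (Rotation.reflTransGen_node (iha hp fun i hi => ?_)
      (ihb (by omega) fun i hi => ?_))
    · rw [hpv i hi]
      exact ha i hi
    · rw [hqv, ← bracket_node_add a b]
      exact h _ (by omega)

end BinaryTree

/-! ### Meets and joins in the Tamari order -/

namespace Tamari

open BinaryTree

variable {m : ℕ}

theorem numNodes_add_one (t : Tamari m) : t.1.numNodes + 1 = m := by
  rw [← numLeaves_eq_numNodes_succ, t.2]

/-- The Tamari order is the componentwise order of bracket vectors. -/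
theorem le_iff_bracket {s t : Tamari m} :
    s ≤ t ↔ ∀ i < t.1.numNodes, s.1.bracket i ≤ t.1.bracket i := by
  have hs := s.numNodes_add_one
  have ht := t.numNodes_add_one
  exact ⟨fun h i _ => bracket_le_of_reflTransGen h i, reflTransGen_of_bracket_le (by omega)⟩

theorem exists_bracket_eq {n : ℕ} {v : ℕ → ℕ} (h : IsBracket n v) :
    ∃ t : Tamari (n + 1), ∀ i < n, t.1.bracket i = v i := by
  obtain ⟨t, rfl, hv⟩ := BinaryTree.exists_bracket_eq h
  exact ⟨⟨t, numLeaves_eq_numNodes_succ t⟩, hv⟩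

/-- Componentwise infima of bracket vectors give greatest lower bounds. -/
theorem exists_isGLB {U : Set (Tamari m)} (hU : U.Nonempty) : ∃ k, IsGLB U k := by
  obtain ⟨u₀, hu₀⟩ := hU
  obtain ⟨n, rfl⟩ : ∃ n, m = n + 1 := ⟨_, u₀.numNodes_add_one.symm⟩
  have hnum (t : Tamari (n + 1)) : t.1.numNodes = n := by
    have := t.numNodes_add_one
    omega
  let v : ℕ → ℕ := fun i => sInf ((fun u : Tamari (n + 1) => u.1.bracket i) '' U)
  have hle (i : ℕ) (u : Tamari (n + 1)) (hu : u ∈ U) : v i ≤ u.1.bracket i :=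
    Nat.sInf_le ⟨u, hu, rfl⟩
  have hatt (i : ℕ) : ∃ u ∈ U, u.1.bracket i = v i := Nat.sInf_mem (Set.Nonempty.image _ ⟨u₀, hu₀⟩)
  have hv : IsBracket n v := by
    constructor
    · intro i hi
      have h₁ := (isBracket_bracket u₀.1).lt i (by rwa [hnum])
      rw [hnum] at h₁
      have h₂ := hle i u₀ hu₀
      omega
    · intro i j hi hij hj
      -- A tree attaining the infimum at `i` satisfies the nesting condition there, and its entry at
      -- `j` bounds `v j`.
      obtain ⟨u, hu, e⟩ := hatt i
      have h₁ := (isBracket_bracket u.1).nested i j (by rwa [hnum]) hij (by omega)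
      have h₂ := hle j u hu
      omega
  obtain ⟨k, hk⟩ := exists_bracket_eq hv
  refine ⟨k, fun u hu => le_iff_bracket.mpr fun i hi => ?_,
    fun l hl => le_iff_bracket.mpr fun i hi => ?_⟩
  · rw [hk i (by rwa [hnum] at hi)]
    exact hle i u hu
  · rw [hnum] at hi
    obtain ⟨u, hu, e⟩ := hatt i
    rw [hk i hi, ← e]
    exact le_iff_bracket.mp (hl hu) i (by rwa [hnum])

theorem exists_top (s : Tamari m) : ∃ t : Tamari m, ∀ r : Tamari m, r ≤ t := by
  obtain ⟨n, rfl⟩ : ∃ n, m = n + 1 := ⟨_, s.numNodes_add_one.symm⟩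
  -- The largest entries allowed by `IsBracket.lt`, realised by the right comb.
  obtain ⟨t, ht⟩ := exists_bracket_eq (n := n) (v := fun i => n - 1 - i)
    ⟨fun i hi => by omega, fun i j hi hij hj => by omega⟩
  refine ⟨t, fun r => le_iff_bracket.mpr fun i hi => ?_⟩
  have h₁ := r.numNodes_add_one
  have h₂ := t.numNodes_add_one
  have h₃ := (isBracket_bracket r.1).lt i (by omega)
  rw [ht i (by omega)]
  omega

/-- Componentwise suprema need not be bracket vectors: `(1,0,0)` and `(0,1,0)` give `(1,1,0)`, which
is not nested. The join is therefore taken as the meet of all upper bounds. -/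
theorem exists_isLUB (s t : Tamari m) : ∃ j, IsLUB {s, t} j := by
  obtain ⟨T, hT⟩ := exists_top s
  obtain ⟨j, hj⟩ := exists_isGLB (U := upperBounds {s, t}) ⟨T, fun r _ => hT r⟩
  exact ⟨j, isGLB_upperBounds.mp hj⟩

end Tamari

theorem mainTheorem3 (m : ℕ) :
    -- `𝓛_m` is a poset: parallel morphisms are equal, and the relation "there is a morphism
    -- from `S` to `T`" is antisymmetric
    (∀ (S T : LaPlaza m) (f g : S ⟶ T), f = g) ∧
    (∀ S T : LaPlaza m, Nonempty (S ⟶ T) → Nonempty (T ⟶ S) → S = T) ∧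
    -- for `m ≥ 3`, forgetting labels identifies `𝓛_m` with the Tamari poset, which is a lattice
    (3 ≤ m →
      (∃ e : LaPlaza m ≃ Tamari m,
        (∀ (S : LaPlaza m) (t : FreeMagma (Fin m)), S.obj = FreeObj.tree t →
          (e S).1 = t.shape) ∧
        (∀ S T : LaPlaza m, Nonempty (S ⟶ T) ↔ e S ≤ e T)) ∧
      (∀ s t : Tamari m, (∃ j, IsLUB {s, t} j) ∧ (∃ k, IsGLB {s, t} k))) := by
  refine ⟨fun S T f g => ?_, fun S T ⟨f⟩ ⟨g⟩ => ?_, fun hm =>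
    ⟨LaPlaza.exists_equiv_tamari (by omega), fun s t =>
      ⟨Tamari.exists_isLUB s t, Tamari.exists_isGLB ⟨s, Set.mem_insert s {t}⟩⟩⟩⟩
  · exact ObjectProperty.hom_ext _ (FreeObj.hom_eq f.hom g.hom)
  · exact ObjectProperty.FullSubcategory.ext (FreeObj.hom_antisymm f.hom g.hom)
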